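/- Setting. Let $\mathcal G$ be a finite directed acyclic graph with vertex set $V$, some of whose vertices are observed and the others latent. A vertex $b$ is a descendant of $a$, and $a$ an ancestor of $b$, if there is a directed path (possibly of length zero) from $a$ to $b$. Each vertex $v$ carries a random variable, also denoted $v$; observed variables are discrete (with countable state spaces), latent ones have arbitrary state spaces. The joint distribution $P$ has density $\prod_{v\in V} f(v\mid \mathrm{pa}_{\mathcal G}(v))$ with respect to a product of $\sigma$-finite measures (counting measures for observed variables), where $f(v\mid \mathrm{pa}_{\mathcal G}(v))$ is a conditional density of $v$ given its parents. The distribution under the intervention $\mathrm{do}(x,d)$, which sets $X=x$ and $D=d$, has the density obtained by deleting from this product the factors of $X$ and of the vertices in $D$ and multiplying by $\mathbb 1_{\{X=x,\,D=d\}}$; $p(y\mid \mathrm{do}(x,d),c)$ is the conditional probability of $Y=y$ given $C=c$ under that distribution. A path (no repeated vertices, edges traversed in either direction) is blocked by $C$ if it has an internal non-collider in $C$ or an internal collider that is not an ancestor of any vertex in $C$; two sets of vertices are d-separated by $C$ if every path between them is blocked by $C$; they are e-separated by $C$ after deletion of $D$ if they are d-separated by $C$ in the induced subgraph on $V\setminus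 D$. Theorem. Suppose that $\mathcal G$ contains the edge $X\to Y$ between observed vertices, and let $C,D$ be sets of observed vertices such that $\{X\},\{Y\},C,D$ are pairwise disjoint and no vertex in $C$ is a descendant of a vertex in $D$. Suppose that in the graph obtained by removing the edge $X\to Y$ from $\mathcal G$, $X$ is e-separated from $Y$ by $C$ after deletion of $D$. Let $$L(x,y,d\mid c)=\max\left\{0,\frac{p(x,y,d\mid c)}{p(x,d\mid c)+1-p(d\mid c)}\right\},\qquad U(x,y,d\mid c)=\min\left\{\frac{p(x,y,d\mid c)+1-p(d\mid c)}{p(x,d\mid c)+1-p(d\mid c)},\,1\right\}.$$ Then, for all values $x,y,d,c$ for which these expressions are well defined (that is, $p(c)>0$, $p(c\mid \mathrm{do}(x,d))>0$ and $p(x,d\mid c)+1-p(d\mid c)>0$), $$L(x,y,d\mid c)\le p(y\mid \mathrm{do}(x,d),c)\le U(x,y,d\mid c).$$ Consequently, for any values $x_0,x_1$ of $X$ and $y_1$ of $Y$ (in particular for binary $X$ and $Y$), the average controlled direct effect $\mathrm{ACDE}_{X\to Y}(d\mid c)=p(y_1\mid \mathrm{do}(x_1,d),c)-p(y_1\mid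 \mathrm{do}(x_0,d),c)$ satisfies, whenever the expressions for $x_0$ and for $x_1$ are well defined, $$L(x_1,y_1,d\mid c)-U(x_0,y_1,d\mid c)\le \mathrm{ACDE}_{X\to Y}(d\mid c)\le U(x_1,y_1,d\mid c)-L(x_0,y_1,d\mid c).$$ If in addition $X$ is not a descendant of any vertex in $D$, then for all values with $p(x,c)>0$ all these expressions are well defined, and the bounds can be strengthened: with $$L'(x,y,d\mid c)=p(y,d\mid x,c),\qquad U'(x,y,d\mid c)=p(y,d\mid x,c)+1-p(d\mid x,c)$$ one has $$L(x,y,d\mid c)\le L'(x,y,d\mid c)\le p(y\mid \mathrm{do}(x,d),c)\le U'(x,y,d\mid c)\le U(x,y,d\mid c),$$ and the bounds on $\mathrm{ACDE}_{X\to Y}(d\mid c)$ hold with $L',U'$ in place of $L,U$ whenever $p(x_0,c)>0$ and $p(x_1,c)>0$. -/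

import Mathlib

open MeasureTheory
open scoped ENNReal

noncomputable section

namespace Digraph

variable {V : Type*}

/-- There is no directed path of positive length from a vertex to itself. -/
def IsDAG (G : Digraph V) : Prop := ∀ v, ¬ Relation.TransGen G.Adj v v

/-- `b` is a descendant of `a`, equivalently `a` is an ancestor of `b`: there is a directed path
from `a` to `b`. The path may have length zero, as usual in the definition of d-separation. -/
def IsDescendant (G : Digraph V) (a b : V) : Prop := Relation.ReflTransGen G.Adj a b

/-- The graph obtained from `G` by removing the edge `X → Y`. -/
def removeEdge (G : Digraph V) (X Y : V) : Digraph V where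
  Adj a b := G.Adj a b ∧ ¬ (a = X ∧ b = Y)

/-- The induced subgraph on a set `W` of vertices. -/
def inducedOn (G : Digraph V) (W : Set V) : Digraph W where
  Adj a b := G.Adj a b

/-- `l` is the list of vertices of a path: consecutive vertices are joined by an edge, in either
direction, and no vertex is repeated. In a DAG two adjacent vertices are joined by exactly one edge,
so that the vertices determine the edges. -/
def IsPath (G : Digraph V) (l : List V) : Prop :=
  l ≠ [] ∧ l.Nodup ∧ l.IsChain (fun a b => G.Adj a b ∨ G.Adj b a)

/-- A path with vertex list `l` is blocked given `C`: some internal vertex `b` of it is a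
non-collider in `C`, or a collider that is not an ancestor of any vertex in `C`. -/
def Blocked (G : Digraph V) (C : Set V) (l : List V) : Prop :=
  ∃ a b c, [a, b, c] <:+: l ∧
    ((¬ (G.Adj a b ∧ G.Adj c b) ∧ b ∈ C) ∨
      ((G.Adj a b ∧ G.Adj c b) ∧ ∀ w ∈ C, ¬ G.IsDescendant b w))

/-- `A` and `B` are d-separated given `C`. -/
def DSep (G : Digraph V) (A B C : Set V) : Prop :=
  ∀ l : List V, G.IsPath l → (∃ a ∈ A, l.head? = some a) → (∃ b ∈ B, l.getLast? = some b) →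
    G.Blocked C l

/-- `A` and `B` are e-separated given `C` after deletion of `D`: they are d-separated given `C` in
the induced subgraph on the complement of `D`. -/
def ESep (G : Digraph V) (A B C D : Set V) : Prop :=
  (G.inducedOn Dᶜ).DSep (Subtype.val ⁻¹' A) (Subtype.val ⁻¹' B) (Subtype.val ⁻¹' C)

end Digraph

/-- A causal model on the directed graph `G`. The vertex `v` carries a random variable with values
in `Ω v`; the vertices in `O` are observed and discrete, the other ones are latent, with
arbitrary state spaces. Here `f v ω` is the conditional density of the variable at `v`, at the
value `ω v`, given that the parents of `v` have the values prescribed by `ω`. -/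
structure CausalModel {V : Type*} [DecidableEq V] (G : Digraph V) (O : Set V)
    (Ω : V → Type*) [∀ v, MeasurableSpace (Ω v)] where
  /-- the reference measures -/
  μ : ∀ v, Measure (Ω v)
  sigmaFinite : ∀ v, SigmaFinite (μ v)
  countable_of_observed : ∀ v ∈ O, Countable (Ω v)
  measurableSingleton_of_observed : ∀ v ∈ O, MeasurableSingletonClass (Ω v)
  count_of_observed : ∀ v ∈ O, μ v = Measure.count
  /-- the conditional densities given the parents -/
  f : V → (∀ u, Ω u) → ℝ≥0∞
  measurable_f : ∀ v, Measurable (f v)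
  dependsOn_f : ∀ v, DependsOn (f v) (insert v {u | G.Adj u v})
  lintegral_f : ∀ v ω, ∫⁻ t, f v (Function.update ω v t) ∂(μ v) = 1

/-- The event that the variables in `S` take the values `s`. -/
def eventEq {V : Type*} {Ω : V → Type*} (S : Finset V) (s : ∀ v : S, Ω v) : Set (∀ v, Ω v) :=
  {ω | ∀ v : S, ω v = s v}

/-- The event that the variable at `X` takes the value `x`. -/
def varEq {V : Type*} {Ω : V → Type*} (X : V) (x : Ω X) : Set (∀ v, Ω v) :=
  {ω | ω X = x}

/-- The conditional probability of the event `A` given the event `B`, as a real number. -/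
def condProb {Ω : Type*} [MeasurableSpace Ω] (P : Measure Ω) (A B : Set Ω) : ℝ :=
  (ProbabilityTheory.cond P B).real A

namespace CausalModel

variable {V : Type*} [Fintype V] [DecidableEq V] {G : Digraph V} {O : Set V}
  {Ω : V → Type*} [∀ v, MeasurableSpace (Ω v)]

/-- The joint distribution `P` of all the variables, with density `∏ f(v | pa(v))`. -/
def joint (M : CausalModel G O Ω) : Measure (∀ v, Ω v) :=
  (Measure.pi M.μ).withDensity (fun ω => ∏ v, M.f v ω)

/-- The distribution of all the variables under the intervention `do(X = x, D = d)`: the factors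
belonging to `X` and to the vertices in `D` are removed from the joint density, which is then
multiplied by the indicator of `{X = x, D = d}`. -/
def doJoint (M : CausalModel G O Ω) (X : V) (D : Finset V) (x : Ω X) (d : ∀ v : D, Ω v) :
    Measure (∀ v, Ω v) :=
  (Measure.pi M.μ).withDensity
    ((varEq X x ∩ eventEq D d).indicator (fun ω => ∏ v ∈ (insert X D)ᶜ, M.f v ω))

/-- `p(y | do(x, d), c)`, the conditional probability of `Y = y` given `C = c` under the
distribution after the intervention. -/
def doProb (M : CausalModel G O Ω) (X Y : V) (C D : Finset V) (x : Ω X) (y : Ω Y)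
    (d : ∀ v : D, Ω v) (c : ∀ v : C, Ω v) : ℝ :=
  condProb (M.doJoint X D x d) (varEq Y y) (eventEq C c)

/-- The average controlled direct effect
`ACDE_{X → Y}(d | c) = p(y₁ | do(x₁, d), c) - p(y₁ | do(x₀, d), c)`. -/
def acde (M : CausalModel G O Ω) (X Y : V) (C D : Finset V) (x₀ x₁ : Ω X) (y₁ : Ω Y)
    (d : ∀ v : D, Ω v) (c : ∀ v : C, Ω v) : ℝ :=
  M.doProb X Y C D x₁ y₁ d c - M.doProb X Y C D x₀ y₁ d c

/-- `p(x, d | c) + 1 - p(d | c)`, the common denominator of the bounds. -/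
def boundDenom (M : CausalModel G O Ω) (X : V) (C D : Finset V) (x : Ω X)
    (d : ∀ v : D, Ω v) (c : ∀ v : C, Ω v) : ℝ :=
  condProb M.joint (varEq X x ∩ eventEq D d) (eventEq C c) + 1
    - condProb M.joint (eventEq D d) (eventEq C c)

/-- `L(x, y, d | c)`. -/
def lowerBound (M : CausalModel G O Ω) (X Y : V) (C D : Finset V) (x : Ω X) (y : Ω Y)
    (d : ∀ v : D, Ω v) (c : ∀ v : C, Ω v) : ℝ :=
  max 0 (condProb M.joint (varEq X x ∩ varEq Y y ∩ eventEq D d) (eventEq C c)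
    / M.boundDenom X C D x d c)

/-- `U(x, y, d | c)`. -/
def upperBound (M : CausalModel G O Ω) (X Y : V) (C D : Finset V) (x : Ω X) (y : Ω Y)
    (d : ∀ v : D, Ω v) (c : ∀ v : C, Ω v) : ℝ :=
  min ((condProb M.joint (varEq X x ∩ varEq Y y ∩ eventEq D d) (eventEq C c) + 1
    - condProb M.joint (eventEq D d) (eventEq C c)) / M.boundDenom X C D x d c) 1

/-- The tighter lower bound `p(y, d | x, c)`. -/
def tightLowerBound (M : CausalModel G O Ω) (X Y : V) (C D : Finset V) (x : Ω X) (y : Ω Y)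
    (d : ∀ v : D, Ω v) (c : ∀ v : C, Ω v) : ℝ :=
  condProb M.joint (varEq Y y ∩ eventEq D d) (varEq X x ∩ eventEq C c)

/-- The tighter upper bound `p(y, d | x, c) + 1 - p(d | x, c)`. -/
def tightUpperBound (M : CausalModel G O Ω) (X Y : V) (C D : Finset V) (x : Ω X) (y : Ω Y)
    (d : ∀ v : D, Ω v) (c : ∀ v : C, Ω v) : ℝ :=
  condProb M.joint (varEq Y y ∩ eventEq D d) (varEq X x ∩ eventEq C c) + 1
    - condProb M.joint (eventEq D d) (varEq X x ∩ eventEq C c)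

/-- All the conditional probabilities and quotients in
`L(x, y, d | c) ≤ p(y | do(x, d), c) ≤ U(x, y, d | c)` are well defined: `p(c) > 0`,
`p(c | do(x, d)) > 0` and `p(x, d | c) + 1 - p(d | c) > 0`. -/
def BoundsDefined (M : CausalModel G O Ω) (X : V) (C D : Finset V) (x : Ω X)
    (d : ∀ v : D, Ω v) (c : ∀ v : C, Ω v) : Prop :=
  M.joint (eventEq C c) ≠ 0 ∧ M.doJoint X D x d (eventEq C c) ≠ 0 ∧ 0 < M.boundDenom X C D x d c

end CausalModel

end

/-! Let P, Q, R be the distributions without intervention, under do(d) and under do(x, d), and put q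
= Q(x, y, c), r = Q(x, c). By e-separation, Y has the same distribution under Q given (x, c) as
under R given c, so the target probability is q / r whenever r ≠ 0.

It remains to compare Q with P. Replacing the factors of D by point masses can only increase the
density on D = d, since mass functions are at most one (`joint_intervene_le`). Hence a := P(x, y, d,
c) ≤ q and b - a ≤ r - q, where b := P(x, d, c). As no vertex of C descends from D, Q(c) = P(c)
(`joint_intervene_of_not_isDescendant`), so r exceeds b by at most k := P(c) - P(d, c). The bounds
arise by assigning all the missing mass k to Y ≠ y or all of it to Y = y. If X does not descend from
D either, then r = P(x, c) is known, and the bounds tighten.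

For the first claim, exploring active walks from Y turns d-separation into a set S of ancestral
vertices that contains Y but not X, such that the family (vertex and parents) of every ancestral
vertex lies in S ∪ C or misses S (`DSep.exists_split`). Restoring D and the edge X → Y adds to the
families that meet S only vertices with fixed values. So, once the non-ancestors are integrated out,
the density with X, C, D fixed is a factor over S times a factor over the rest
(`lintegral_mul_indicator_agree`). Intervening on X changes only the second factor, so Q and R are
proportional on events about Y (`exists_joint_intervene_eq_mul`). -/

noncomputable section

namespace Digraph

/-! ### Active walks, and d-separation as a splitting of ancestral vertices -/

section BayesBall

variable {V : Type*}

/-- `BayesBall G C Y v b` : there is an active walk given `C` from `Y` to `v`, whose last edge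
points to `v` if and only if `b` is `true`. -/
inductive BayesBall (G : Digraph V) (C : Set V) (Y : V) : V → Bool → Prop
  | start : BayesBall G C Y Y false
  | child {v w : V} {b : Bool} : BayesBall G C Y v b → v ∉ C → G.Adj v w → BayesBall G C Y w true
  | parent {v w : V} : BayesBall G C Y v false → v ∉ C → G.Adj w v → BayesBall G C Y w false
  | collider {v w : V} : BayesBall G C Y v true → (∃ u ∈ C, G.IsDescendant v u) → G.Adj w v →
      BayesBall G C Y w false

/-- `ActivePath G C Y v l b` : the list `v :: l` is an active path given `C` from `v` to `Y`, and
its edge at `v` points to `v` if and only if `b` is `true`. -/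
inductive ActivePath (G : Digraph V) (C : Set V) (Y : V) : V → List V → Bool → Prop
  | start : ActivePath G C Y Y [] false
  | child {v w : V} {l : List V} {b : Bool} : ActivePath G C Y v l b → v ∉ C → G.Adj v w →
      w ∉ v :: l → ActivePath G C Y w (v :: l) true
  | parent {v w : V} {l : List V} : ActivePath G C Y v l false → v ∉ C → G.Adj w v →
      w ∉ v :: l → ActivePath G C Y w (v :: l) false
  | collider {v w : V} {l : List V} : ActivePath G C Y v l true →
      (∃ u ∈ C, G.IsDescendant v u) → G.Adj w v → w ∉ v :: l → ActivePath G C Y w (v :: l) false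

variable {G : Digraph V} {C : Set V} {X Y : V}

/-- Cut the path at `w` and keep the part towards `Y`. If its edge points to `w`, then either `w`
was a collider, or the discarded part leaves `w` along an arrow. Following arrows from there leads
to a collider, which has a descendant in `C`, or all the way to `v`. -/
theorem ActivePath.exists_of_mem {v w : V} {l : List V} {b : Bool}
    (h : G.ActivePath C Y v l b) (hw : w ∈ l) :
    ∃ l' b', G.ActivePath C Y w l' b' ∧ (b' = false → w ∉ C) ∧
      (b' = true → (∃ u ∈ C, G.IsDescendant w u) ∨ (w ∉ C ∧ G.IsDescendant w v ∧ b = true)) := by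
  induction h with
  | start => simp at hw
  | @child v w' l b h hv hadj hw' ih =>
    rcases List.mem_cons.1 hw with rfl | hw
    · exact ⟨l, b, h, fun _ => hv, fun _ => .inr ⟨hv, .single hadj, rfl⟩⟩
    · obtain ⟨l', b', h1, h2, h3⟩ := ih hw
      exact ⟨l', b', h1, h2, fun hb => (h3 hb).imp id
        fun h4 => ⟨h4.1, h4.2.1.tail hadj, rfl⟩⟩
  | @parent v w' l h hv hadj hw' ih =>
    rcases List.mem_cons.1 hw with rfl | hw
    · exact ⟨l, false, h, fun _ => hv, by simp⟩
    · obtain ⟨l', b', h1, h2, h3⟩ := ih hw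
      exact ⟨l', b', h1, h2, fun hb => by simpa using h3 hb⟩
  | @collider v w' l h hv hadj hw' ih =>
    rcases List.mem_cons.1 hw with rfl | hw
    · exact ⟨l, true, h, by simp, fun _ => .inl hv⟩
    · obtain ⟨l', b', h1, h2, h3⟩ := ih hw
      refine ⟨l', b', h1, h2, fun hb => .inl ?_⟩
      rcases h3 hb with h4 | h4
      · exact h4
      · obtain ⟨u, hu, hvu⟩ := hv
        exact ⟨u, hu, h4.2.1.trans hvu⟩

/-- An active walk can be shortened to an active path, from which it can be continued in the same
ways. -/
theorem BayesBall.exists_activePath (hG : G.IsDAG) {v : V} {b : Bool}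
    (h : G.BayesBall C Y v b) :
    ∃ l b', G.ActivePath C Y v l b' ∧
      (b' = b ∨ (b' = true ∧ ∃ u ∈ C, G.IsDescendant v u) ∨ (b' = false ∧ v ∉ C)) := by
  induction h with
  | start => exact ⟨[], false, .start, .inl rfl⟩
  | @child v w b h hv hadj ih =>
    obtain ⟨l, b', hp, -⟩ := ih
    -- When the walk returns to a vertex of the path, the path is cut there instead of extended.
    by_cases hw : w ∈ v :: l
    · rcases List.mem_cons.1 hw with rfl | hw
      · exact absurd (.single hadj) (hG w)
      · obtain ⟨l', b'', h1, h2, -⟩ := hp.exists_of_mem hw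
        cases b'' with
        | false => exact ⟨l', _, h1, .inr (.inr ⟨rfl, h2 rfl⟩)⟩
        | true => exact ⟨l', _, h1, .inl rfl⟩
    · exact ⟨_, _, .child hp hv hadj hw, .inl rfl⟩
  | @parent v w h hv hadj ih =>
    obtain ⟨l, b', hp, hb⟩ := ih
    have hb : b' = false ∨ (b' = true ∧ ∃ u ∈ C, G.IsDescendant v u) := by tauto
    by_cases hw : w ∈ v :: l
    · rcases List.mem_cons.1 hw with rfl | hw
      · exact absurd (.single hadj) (hG w)
      · obtain ⟨l', b'', h1, h2, h3⟩ := hp.exists_of_mem hw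
        cases b'' with
        | false => exact ⟨l', _, h1, .inl rfl⟩
        | true =>
          refine ⟨l', _, h1, .inr (.inl ⟨rfl, ?_⟩)⟩
          -- In the second case the path arrives at `v` by an arrow, so `v` has a descendant in `C`,
          -- and its parent `w` inherits it.
          rcases h3 rfl with h4 | ⟨-, -, rfl⟩
          · exact h4
          · obtain ⟨u, hu, hvu⟩ := (hb.resolve_left (by simp)).2
            exact ⟨u, hu, .head hadj hvu⟩
    · rcases hb with rfl | ⟨rfl, hb⟩
      · exact ⟨_, _, .parent hp hv hadj hw, .inl rfl⟩
      · exact ⟨_, _, .collider hp (by simpa using hb) hadj hw, .inl rfl⟩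
  | @collider v w h hv hadj ih =>
    obtain ⟨l, b', hp, hb⟩ := ih
    by_cases hw : w ∈ v :: l
    · rcases List.mem_cons.1 hw with rfl | hw
      · exact absurd (.single hadj) (hG w)
      · obtain ⟨l', b'', h1, h2, h3⟩ := hp.exists_of_mem hw
        cases b'' with
        | false => exact ⟨l', _, h1, .inl rfl⟩
        | true =>
          obtain ⟨u, hu, hvu⟩ := hv
          exact ⟨l', _, h1, .inr (.inl ⟨rfl, u, hu, .head hadj hvu⟩)⟩
    · cases b' with
      | true => exact ⟨_, _, .collider hp hv hadj hw, .inl rfl⟩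
      | false => exact ⟨_, _, .parent hp (by simpa using hb) hadj hw, .inl rfl⟩

theorem IsDAG.not_adj_of_adj (hG : G.IsDAG) {a b : V} (h : G.Adj a b) : ¬ G.Adj b a :=
  fun h' => hG a (.tail (.single h) h')

theorem ActivePath.head_adj {v w : V} {l : List V} {b : Bool}
    (h : G.ActivePath C Y v (w :: l) b) : (b = true ∧ G.Adj w v) ∨ (b = false ∧ G.Adj v w) := by
  cases h <;> simp_all

theorem ActivePath.isPath {v : V} {l : List V} {b : Bool} (h : G.ActivePath C Y v l b) :
    G.IsPath (v :: l) ∧ (v :: l).getLast? = some Y := by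
  induction h with
  | start => simp [IsPath]
  | _ => simp_all [IsPath]

/-- Each constructor imposes exactly the condition for openness at the vertex it makes internal.
Acyclicity ensures that an edge is not directed both ways, so colliders are recognised correctly. -/
theorem ActivePath.not_blocked (hG : G.IsDAG) {v : V} {l : List V} {b : Bool}
    (h : G.ActivePath C Y v l b) : ¬ G.Blocked C (v :: l) := by
  have key : ∀ {v w : V} {l : List V}, w ∉ v :: l → ¬ G.Blocked C (v :: l) →
      (∀ u l', l = u :: l' →
        ¬ ((¬ (G.Adj w v ∧ G.Adj u v) ∧ v ∈ C) ∨
      ((G.Adj w v ∧ G.Adj u v) ∧ ∀ w ∈ C, ¬ G.IsDescendant v w))) →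
      ¬ G.Blocked C (w :: v :: l) := by
    rintro v w l - h1 h2 ⟨a, b, c, hi, hb⟩
    rcases List.infix_cons_iff.1 hi with hi | hi
    · obtain ⟨t, ht⟩ := hi
      simp only [List.cons_append, List.nil_append, List.cons.injEq] at ht
      obtain ⟨rfl, rfl, rfl⟩ := ht
      exact h2 _ _ rfl hb
    · exact h1 ⟨a, b, c, hi, hb⟩
  induction h with
  | start =>
    rintro ⟨a, b, c, hi, -⟩
    have := hi.length_le
    simp at this
  | @child v w l b h hv hadj hw ih =>
    refine key hw ih ?_
    rintro u l' rfl
    have := hG.not_adj_of_adj hadj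
    tauto
  | @parent v w l h hv hadj hw ih =>
    refine key hw ih ?_
    rintro u l' rfl
    have h1 : G.Adj v u := by simpa using h.head_adj
    have := hG.not_adj_of_adj h1
    tauto
  | @collider v w l h hv hadj hw ih =>
    refine key hw ih ?_
    rintro u l' rfl
    have h1 : G.Adj u v := by simpa using h.head_adj
    rintro (h2 | h2)
    · exact h2.1 ⟨hadj, h1⟩
    · obtain ⟨u, hu, hvu⟩ := hv
      exact h2.2 u hu hvu

theorem DSep.not_bayesBall (hG : G.IsDAG) (hsep : G.DSep {X} {Y} C) (b : Bool) :
    ¬ G.BayesBall C Y X b := by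
  intro h
  obtain ⟨l, b', hp, -⟩ := h.exists_activePath hG
  exact hp.not_blocked hG (hsep _ hp.isPath.1 ⟨X, rfl, rfl⟩ ⟨Y, rfl, hp.isPath.2⟩)

/-- A directed path from `v` consists of non-colliders outside `C`, so the walk can follow it. -/
theorem BayesBall.of_isDescendant {v w : V} {b : Bool} (h : G.BayesBall C Y v b)
    (hC : ∀ u ∈ C, ¬ G.IsDescendant v u) (hvw : G.IsDescendant v w) :
    ∃ b', G.BayesBall C Y w b' := by
  induction hvw with
  | refl => exact ⟨b, h⟩
  | @tail u w hvu huw ih =>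
    obtain ⟨b', h'⟩ := ih
    exact ⟨true, h'.child (fun hu => hC u hu hvu) huw⟩

theorem bayesBall_false_of_isDescendant {v : V} (hC : ∀ u ∈ C, ¬ G.IsDescendant v u)
    (hvY : G.IsDescendant v Y) : G.BayesBall C Y v false := by
  induction hvY using Relation.ReflTransGen.head_induction_on with
  | refl => exact .start
  | @head v w hvw hwY ih =>
    have hw : ∀ u ∈ C, ¬ G.IsDescendant w u := fun u hu h => hC u hu (.head hvw h)
    exact (ih hw).parent (fun h => hw w h .refl) hvw

/-- If `X` and `Y` are d-separated given `C`, then the ancestors of `X`, `Y` and `C` outside of `C`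
can be split into two parts, one with `X` and the other with `Y`, such that no vertex together with
its parents meets both parts. -/
theorem DSep.exists_split (hG : G.IsDAG) (hsep : G.DSep {X} {Y} C) (hYC : Y ∉ C) :
    ∃ S : Set V, Y ∈ S ∧ X ∉ S ∧ Disjoint S C ∧
      (∀ v ∈ S, ∃ w ∈ insert X (insert Y C), G.IsDescendant v w) ∧
      ∀ v, (∃ w ∈ insert X (insert Y C), G.IsDescendant v w) →
        (∀ u ∈ insert v {u | G.Adj u v}, u ∈ S ∪ C) ∨
        (∀ u ∈ insert v {u | G.Adj u v}, u ∉ S) := by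
  have hX := hsep.not_bayesBall hG
  -- A walk entering an ancestral vertex by an arrow can bounce back to its parents. If the collider
  -- is not opened by `C`, then `v` is an ancestor of `X`, which the walk would then reach, or of
  -- `Y`, and then `v` is also reached from `Y` against the arrows.
  have hpar : ∀ v, (∃ w ∈ insert X (insert Y C), G.IsDescendant v w) → G.BayesBall C Y v true →
      ∀ w, G.Adj w v → G.BayesBall C Y w false := by
    intro v hv h w hwv
    by_cases hC : ∃ u ∈ C, G.IsDescendant v u
    · exact h.collider hC hwv
    · have hC' : ∀ u ∈ C, ¬ G.IsDescendant v u := fun u hu h => hC ⟨u, hu, h⟩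
      obtain ⟨z, (rfl | rfl | hz), hvz⟩ := hv
      · obtain ⟨b', h'⟩ := h.of_isDescendant hC' hvz
        exact absurd h' (hX b')
      · exact (bayesBall_false_of_isDescendant hC' hvz).parent (fun h => hC' v h .refl) hwv
      · exact absurd hvz (hC' z hz)
  refine ⟨{v | v ∉ C ∧ (∃ w ∈ insert X (insert Y C), G.IsDescendant v w) ∧
    ∃ b, G.BayesBall C Y v b}, ⟨hYC, ⟨Y, by simp, .refl⟩, false, .start⟩, ?_, ?_, ?_, ?_⟩
  · rintro ⟨-, -, b, h⟩
    exact hX b h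
  · exact Set.disjoint_left.2 fun v hv => hv.1
  · exact fun v hv => hv.2.1
  · intro v hv
    have hanc : ∀ u, G.Adj u v → ∃ w ∈ insert X (insert Y C), G.IsDescendant u w := by
      obtain ⟨w, hw, hvw⟩ := hv
      exact fun u hu => ⟨w, hw, .head hu hvw⟩
    -- Once one member of the family outside `C` is reached, so are all its members outside `C`.
    by_cases hS : ∃ u ∈ insert v {u | G.Adj u v}, u ∉ C ∧ ∃ b, G.BayesBall C Y u b
    · left
      have hpa : ∀ w, G.Adj w v → G.BayesBall C Y w false := by
        obtain ⟨u, (rfl | hu), huC, b, hb⟩ := hS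
        · cases b with
          | false => exact fun w hw => hb.parent huC hw
          | true => exact hpar u hv hb
        · exact hpar v hv (hb.child huC hu)
      have hself : v ∉ C → ∃ b, G.BayesBall C Y v b := by
        intro _
        obtain ⟨u, (rfl | hu), huC, b, hb⟩ := hS
        · exact ⟨b, hb⟩
        · exact ⟨_, hb.child huC hu⟩
      intro u hu
      by_cases huC : u ∈ C
      · exact .inr huC
      · left
        rcases hu with rfl | hu
        · exact ⟨huC, hv, hself huC⟩
        · exact ⟨huC, hanc u hu, false, hpa u hu⟩
    · right
      rintro u hu ⟨h1, -, h2⟩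
      exact hS ⟨u, hu, h1, h2⟩

end BayesBall

end Digraph

/-! ### Graphs with incoming edges removed, and sinks -/

namespace Digraph

variable {V : Type*}

/-- The graph obtained from `G` by removing all edges into vertices of `K`. -/
def removeInto (G : Digraph V) (K : Set V) : Digraph V where
  Adj a b := G.Adj a b ∧ b ∉ K

theorem IsDAG.mono {G H : Digraph V} (hG : G.IsDAG) (h : ∀ a b, H.Adj a b → G.Adj a b) :
    H.IsDAG :=
  fun v hv => hG v (Relation.TransGen.mono h _ _ hv)

theorem IsDAG.removeInto {G : Digraph V} (hG : G.IsDAG) (K : Set V) : (G.removeInto K).IsDAG :=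
  hG.mono fun _ _ h => h.1

theorem IsDAG.exists_sink {G : Digraph V} (hG : G.IsDAG) {s : Finset V}
    (hs : s.Nonempty) : ∃ i ∈ s, ∀ u ∈ s, ¬ G.Adj i u := by
  have : IsStrictOrder V (flip (Relation.TransGen G.Adj)) :=
    { irrefl := hG, trans := fun _ _ _ h₁ h₂ => h₂.trans h₁ }
  obtain ⟨i, hi, h⟩ := (s.finite_toSet.wellFoundedOn (r := flip (Relation.TransGen G.Adj))).has_min
    Set.univ ⟨⟨hs.choose, hs.choose_spec⟩, trivial⟩
  exact ⟨i, i.2, fun u hu hiu => h ⟨u, hu⟩ trivial (.single hiu)⟩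

end Digraph

/-! ### Events fixing coordinates, and dependence on coordinates -/

section Agree

variable {V : Type*} {Ω : V → Type*}

/-- The event that the variables in `K` take the same values as in `ω₀`. -/
def agree (K : Set V) (ω₀ : ∀ v, Ω v) : Set (∀ v, Ω v) :=
  {ω | ∀ v ∈ K, ω v = ω₀ v}

theorem agree_union (K L : Set V) (ω₀ : ∀ v, Ω v) :
    agree (K ∪ L) ω₀ = agree K ω₀ ∩ agree L ω₀ := by
  ext ω
  simp [agree, or_imp, forall_and]

theorem eventEq_eq_agree (S : Finset V) (ω₀ : ∀ v, Ω v) :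
    eventEq S (fun v => ω₀ v) = agree (S : Set V) ω₀ := by
  ext ω
  simp [eventEq, agree]

theorem varEq_eq_agree (X : V) (ω₀ : ∀ v, Ω v) : varEq X (ω₀ X) = agree {X} ω₀ := by
  ext ω
  simp [varEq, agree]

theorem DependsOn.mul' {f g : (∀ v, Ω v) → ℝ≥0∞} {s : Set V} (hf : DependsOn f s)
    (hg : DependsOn g s) : DependsOn (fun ω => f ω * g ω) s := fun _ _ h => by
  simp only [hf h, hg h]

theorem dependsOn_finset_prod {f : V → (∀ v, Ω v) → ℝ≥0∞} {s : Set V} {R : Finset V}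
    (hf : ∀ v ∈ R, DependsOn (f v) s) : DependsOn (fun ω => ∏ v ∈ R, f v ω) s :=
  fun _ _ h => Finset.prod_congr rfl fun v hv => hf v hv h

theorem dependsOn_indicator_agree (K : Set V) (ω₀ : ∀ v, Ω v) :
    DependsOn ((agree K ω₀).indicator (1 : (∀ v, Ω v) → ℝ≥0∞)) K := by
  intro ω ω' h
  have : ω ∈ agree K ω₀ ↔ ω' ∈ agree K ω₀ := by
    refine forall₂_congr fun v hv => ?_
    rw [h v hv]
  by_cases hω : ω ∈ agree K ω₀
  · simp [hω, this.1 hω]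
  · simp [hω, mt this.2 hω]

end Agree

/-! ### Marginalization and interventions -/

namespace CausalModel

variable {V : Type*} [DecidableEq V] {G : Digraph V} {O : Set V}
  {Ω : V → Type*} [∀ v, MeasurableSpace (Ω v)]

instance (M : CausalModel G O Ω) (v : V) : SigmaFinite (M.μ v) := M.sigmaFinite v

theorem measurableSet_varEq (M : CausalModel G O Ω) {v : V} (hv : v ∈ O) (x : Ω v) :
    MeasurableSet (varEq v x) := by
  have := M.measurableSingleton_of_observed v hv
  exact measurable_pi_apply v (measurableSet_singleton x)

/-- With counting measure as reference, the density is a mass function, and each value is one term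
of a sum equal to one. -/
theorem f_le_one (M : CausalModel G O Ω) {v : V} (hv : v ∈ O) (ω : ∀ v, Ω v) : M.f v ω ≤ 1 := by
  have := M.measurableSingleton_of_observed v hv
  have h := M.lintegral_f v ω
  rw [M.count_of_observed v hv, lintegral_count] at h
  rw [← h]
  simpa using ENNReal.le_tsum (f := fun t => M.f v (Function.update ω v t)) (ω v)

theorem f_update_of_notMem (M : CausalModel G O Ω) {u v : V} (h : u ≠ v) (hadj : ¬ G.Adj u v)
    (ω : ∀ v, Ω v) (t : Ω u) : M.f v (Function.update ω u t) = M.f v ω := by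
  refine M.dependsOn_f v fun w hw => Function.update_of_ne ?_ _ _
  rintro rfl
  rcases hw with hw | hw
  · exact h hw
  · exact hadj hw

theorem measurable_prod (M : CausalModel G O Ω) (R : Finset V) :
    Measurable (fun ω => ∏ v ∈ R, M.f v ω) :=
  Finset.measurable_fun_prod _ fun v _ => M.measurable_f v

/-- Variables which are not parents of any remaining one can be integrated out. -/
theorem lmarginal_mul_prod (M : CausalModel G O Ω) (hG : G.IsDAG) (s : Finset V) :
    ∀ (R : Finset V), s ⊆ R → (∀ v ∈ R, v ∉ s → ∀ u ∈ s, ¬ G.Adj u v) →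
    ∀ (g : (∀ v, Ω v) → ℝ≥0∞), Measurable g → DependsOn g (s : Set V)ᶜ →
    ∫⋯∫⁻_s, (fun ω => g ω * ∏ v ∈ R, M.f v ω) ∂M.μ = fun ω => g ω * ∏ v ∈ R \ s, M.f v ω := by
  induction s using Finset.strongInduction with
  | H s ih =>
  intro R hsR hR g hg hgs
  rcases s.eq_empty_or_nonempty with rfl | hs
  · simp
  -- Integrate a sink of `s` first: its own factor is the only one involving it, and integrates to
  -- one.
  obtain ⟨i, hi, hsink⟩ := hG.exists_sink hs
  have hmeas : Measurable (fun ω => g ω * ∏ v ∈ R, M.f v ω) := hg.mul (M.measurable_prod R)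
  have hinner : (fun ω => ∫⁻ t, (fun ω => g ω * ∏ v ∈ R, M.f v ω) (Function.update ω i t) ∂M.μ i)
      = fun ω => g ω * ∏ v ∈ R.erase i, M.f v ω := by
    funext ω
    have h1 : ∀ t, g (Function.update ω i t) = g ω := fun t =>
      hgs fun w hw => Function.update_of_ne (by rintro rfl; exact hw hi) _ _
    have h2 : ∀ t, ∏ v ∈ R, M.f v (Function.update ω i t) =
        (∏ v ∈ R.erase i, M.f v ω) * M.f i (Function.update ω i t) := by
      intro t
      rw [← Finset.prod_erase_mul _ _ (hsR hi)]
      congr 1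
      refine Finset.prod_congr rfl fun v hv => M.f_update_of_notMem (Finset.ne_of_mem_erase hv).symm ?_ _ _
      by_cases hvs : v ∈ s
      · exact hsink v hvs
      · exact hR v (Finset.mem_of_mem_erase hv) hvs i hi
    have h3 : Measurable fun t => M.f i (Function.update ω i t) :=
      (M.measurable_f i).comp (measurable_update ω)
    simp only [h1, h2, ← mul_assoc]
    rw [lintegral_const_mul _ h3, M.lintegral_f, mul_one]
  rw [lmarginal_erase' _ hmeas hi, hinner, ih _ (Finset.erase_ssubset hi) (R.erase i)
    (Finset.erase_subset_erase i hsR) ?_ g hg ?_]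
  · have : R.erase i \ s.erase i = R \ s := by
      ext v
      by_cases h : v = i <;> simp [h, hi]
    rw [this]
  · intro v hv hvs u hu
    have hvi := Finset.ne_of_mem_erase hv
    exact hR v (Finset.mem_of_mem_erase hv) (fun h => hvs (Finset.mem_erase.2 ⟨hvi, h⟩)) u
      (Finset.mem_of_mem_erase hu)
  · exact hgs.mono (Set.compl_subset_compl.2 (by simp))

theorem measurableSet_agree [Finite V] (M : CausalModel G O Ω) {K : Set V} (hK : K ⊆ O) (ω₀ : ∀ v, Ω v) :
    MeasurableSet (agree K ω₀) := by
  have : agree K ω₀ = ⋂ v ∈ K, varEq v (ω₀ v) := by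
    ext ω
    simp [agree, varEq]
  rw [this]
  exact .biInter (Set.to_countable K) fun v hv => M.measurableSet_varEq (hK hv) _

/-- The model in which the variables in `K` are set to their values in `ω₀`. -/
def intervene [Finite V] (M : CausalModel G O Ω) (K : Set V) (hK : K ⊆ O) (ω₀ : ∀ v, Ω v) :
    CausalModel (G.removeInto K) O Ω where
  μ := M.μ
  sigmaFinite := M.sigmaFinite
  countable_of_observed := M.countable_of_observed
  measurableSingleton_of_observed := M.measurableSingleton_of_observed
  count_of_observed := M.count_of_observed
  -- Point masses instead of deleted factors keep every factor normalised, so that the result is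
  -- again a causal model and all lemmas apply to it.
  f v := open Classical in if v ∈ K then (varEq v (ω₀ v)).indicator 1 else M.f v
  measurable_f v := by
    split_ifs with h
    · exact measurable_one.indicator (M.measurableSet_varEq (hK h) _)
    · exact M.measurable_f v
  dependsOn_f v := by
    split_ifs with h
    · rw [varEq_eq_agree]
      exact (dependsOn_indicator_agree _ _).mono (by simp)
    · exact (M.dependsOn_f v).mono (Set.insert_subset_insert fun u hu => ⟨hu, h⟩)
  lintegral_f v ω := by
    split_ifs with h
    · have := M.measurableSingleton_of_observed v (hK h)
      have : ∀ t, (varEq v (ω₀ v)).indicator (1 : (∀ v, Ω v) → ℝ≥0∞) (Function.update ω v t)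
          = ({ω₀ v} : Set (Ω v)).indicator 1 t := by
        intro t
        by_cases ht : t = ω₀ v <;> simp [Set.indicator, varEq, ht]
      simp only [this]
      rw [lintegral_indicator_one (measurableSet_singleton _), M.count_of_observed v (hK h)]
      simp
    · exact M.lintegral_f v ω

section intervene

variable [Finite V] (M : CausalModel G O Ω) {K : Set V} (hK : K ⊆ O) (ω₀ : ∀ v, Ω v)

theorem intervene_f_of_notMem {v : V} (hv : v ∉ K) :
    (M.intervene K hK ω₀).f v = M.f v := by
  simp [intervene, hv]

theorem intervene_f_of_mem {v : V} (hv : v ∈ K) :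
    (M.intervene K hK ω₀).f v = (varEq v (ω₀ v)).indicator 1 := by
  simp [intervene, hv]

end intervene

variable [Fintype V]

theorem joint_apply (M : CausalModel G O Ω) (E : Set (∀ v, Ω v)) :
    M.joint E = ∫⁻ ω in E, ∏ v, M.f v ω ∂(Measure.pi M.μ) := withDensity_apply' _ _

theorem joint_apply_indicator (M : CausalModel G O Ω) {E : Set (∀ v, Ω v)} (hE : MeasurableSet E) :
    M.joint E = ∫⁻ ω, E.indicator 1 ω * ∏ v, M.f v ω ∂(Measure.pi M.μ) := by
  rw [joint_apply, ← lintegral_indicator hE]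
  congr 1
  funext ω
  by_cases h : ω ∈ E <;> simp [h]

theorem joint_univ (M : CausalModel G O Ω) (hG : G.IsDAG) [Nonempty (∀ v, Ω v)] :
    M.joint Set.univ = 1 := by
  have h := M.lmarginal_mul_prod hG Finset.univ Finset.univ subset_rfl
    (fun v _ hv => absurd (Finset.mem_univ v) hv) (fun _ => 1) measurable_const
    (fun _ _ _ => rfl)
  rw [M.joint_apply_indicator .univ, lintegral_eq_lmarginal_univ (Classical.arbitrary _)]
  simpa using congrFun h (Classical.arbitrary _)

section intervene

variable (M : CausalModel G O Ω) {K : Set V} (hK : K ⊆ O) (ω₀ : ∀ v, Ω v)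

theorem joint_intervene_empty :
    (M.intervene ∅ (Set.empty_subset _) ω₀).joint = M.joint := by
  simp [joint, intervene]

theorem joint_intervene (S : Finset V) (hS : (S : Set V) ⊆ O) :
    (M.intervene S hS ω₀).joint = (Measure.pi M.μ).withDensity
      ((agree (S : Set V) ω₀).indicator fun ω => ∏ v ∈ Sᶜ, M.f v ω) := by
  rw [joint]
  congr 1
  funext ω
  rw [← Finset.prod_mul_prod_compl S]
  have h2 : ∏ v ∈ Sᶜ, (M.intervene S hS ω₀).f v ω = ∏ v ∈ Sᶜ, M.f v ω :=
    Finset.prod_congr rfl fun v hv => by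
      rw [intervene_f_of_notMem]
      simpa using hv
  rw [h2]
  by_cases h : ω ∈ agree (S : Set V) ω₀
  · rw [Set.indicator_of_mem h, Finset.prod_eq_one, one_mul]
    intro v hv
    rw [M.intervene_f_of_mem hS ω₀ (by simpa using hv)]
    exact Set.indicator_of_mem (show ω ∈ varEq v (ω₀ v) from h v hv) _
  · rw [Set.indicator_of_notMem h]
    obtain ⟨v, hv, hne⟩ : ∃ v ∈ S, ω v ≠ ω₀ v := by simpa [agree] using h
    rw [Finset.prod_eq_zero hv, zero_mul]
    rw [M.intervene_f_of_mem hS ω₀ (by simpa using hv)]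
    exact Set.indicator_of_notMem (show ω ∉ varEq v (ω₀ v) from hne) _

theorem doJoint_eq_joint_intervene {X : V} {D : Finset V} (hS : ((insert X D : Finset V) : Set V) ⊆ O) :
    M.doJoint X D (ω₀ X) (fun v => ω₀ v) =
      (M.intervene (insert X D : Finset V) hS ω₀).joint := by
  rw [joint_intervene, doJoint, varEq_eq_agree, eventEq_eq_agree, ← agree_union, Finset.coe_insert,
    Set.insert_eq]

/-- The density after the intervention vanishes outside the event of the prescribed values. -/
theorem joint_intervene_inter_agree (S : Finset V) (hS : (S : Set V) ⊆ O) (E : Set (∀ v, Ω v)) :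
    (M.intervene S hS ω₀).joint (E ∩ agree (S : Set V) ω₀) = (M.intervene S hS ω₀).joint E := by
  rw [joint_intervene, withDensity_indicator (M.measurableSet_agree hS ω₀),
    withDensity_apply', withDensity_apply', Measure.restrict_restrict_of_subset Set.inter_subset_right,
    Measure.restrict_restrict' (M.measurableSet_agree hS ω₀)]

/-- Intervening on variables can only increase the mass of the event that they have the values
which the intervention gives to them. -/
theorem joint_intervene_le {K' : Set V} (hKK' : K ⊆ K') (hK' : K' ⊆ O) (E : Set (∀ v, Ω v)) :
    (M.intervene K hK ω₀).joint (E ∩ agree K' ω₀) ≤ (M.intervene K' hK' ω₀).joint E := by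
  refine le_trans ?_ (measure_mono (Set.inter_subset_left (t := agree K' ω₀)))
  rw [joint_apply, joint_apply]
  -- Compare factor by factor: on the event, the factors of `K'` become 1, and the others are
  -- unchanged.
  refine setLIntegral_mono (measurable_prod (M.intervene K' hK' ω₀) _) fun ω hω => Finset.prod_le_prod' fun v _ => ?_
  by_cases hv : v ∈ K'
  · rw [M.intervene_f_of_mem hK' ω₀ hv]
    rw [Set.indicator_of_mem (show ω ∈ varEq v (ω₀ v) from hω.2 v hv)]
    exact f_le_one _ (hK' hv) ω
  · rw [M.intervene_f_of_notMem hK' ω₀ hv, M.intervene_f_of_notMem hK ω₀ fun h => hv (hKK' h)]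

/-- An intervention does not change the distribution of the non-descendants. -/
theorem joint_intervene_of_not_isDescendant (hG : G.IsDAG) {N : Set V} (hN : N ⊆ O)
    (h : ∀ a ∈ K, ∀ b ∈ N, ¬ G.IsDescendant a b) :
    (M.intervene K hK ω₀).joint (agree N ω₀) = M.joint (agree N ω₀) := by
  classical
  have hE := M.measurableSet_agree hN ω₀
  -- The descendants of `K` are closed under children, so they can be integrated out of both models;
  -- the factors that remain coincide.
  set s : Finset V := Finset.univ.filter fun v => ∃ a ∈ K, G.IsDescendant a v with hs
  have hclosed : ∀ v ∉ s, ∀ u ∈ s, ¬ G.Adj u v := by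
    simp only [hs, Finset.mem_filter, Finset.mem_univ, true_and]
    rintro v hv u ⟨a, ha, hau⟩ huv
    exact hv ⟨a, ha, hau.tail huv⟩
  have hdep : DependsOn ((agree N ω₀).indicator (1 : (∀ v, Ω v) → ℝ≥0∞)) (s : Set V)ᶜ := by
    refine (dependsOn_indicator_agree N ω₀).mono fun b hb hbs => ?_
    obtain ⟨a, ha, hab⟩ : ∃ a ∈ K, G.IsDescendant a b := by simpa [hs] using hbs
    exact h a ha b hb hab
  rw [M.joint_apply_indicator hE, joint_apply_indicator _ hE]
  refine lintegral_eq_of_lmarginal_eq s ?_ ?_ ?_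
  · exact (measurable_one.indicator hE).mul (measurable_prod _ _)
  · exact (measurable_one.indicator hE).mul (measurable_prod _ _)
  · refine Eq.trans ?_ (M.lmarginal_mul_prod hG s Finset.univ (Finset.subset_univ _)
      (fun v _ => hclosed v) _ (measurable_one.indicator hE) hdep).symm
    refine ((M.intervene K hK ω₀).lmarginal_mul_prod (hG.removeInto K) s Finset.univ
      (Finset.subset_univ _) (fun v _ hv u hu huv => hclosed v hv u hu huv.1) _
      (measurable_one.indicator hE) hdep).trans ?_
    funext ω
    congr 1
    refine Finset.prod_congr rfl fun v hv => ?_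
    rw [M.intervene_f_of_notMem]
    intro hvK
    simp only [hs, Finset.mem_sdiff, Finset.mem_filter, Finset.mem_univ, true_and] at hv
    exact hv ⟨v, hvK, .refl⟩

end intervene

/-- If no vertex of an ancestral set `W` together with its parents meets both `S` and the complement
of `S ∪ K`, then given the values of the variables in `K`, the joint density of the variables in `W`
splits into a factor with the variables in `S` and another one with the remaining variables. -/
theorem lintegral_mul_indicator_agree (M : CausalModel G O Ω) (hG : G.IsDAG) (ω₀ : ∀ v, Ω v)
    {W S T : Finset V} {K : Set V} (hKO : K ⊆ O)
    (hW : ∀ v ∈ W, ∀ u, G.Adj u v → u ∈ W) (hSW : S ⊆ W) (hTW : T ⊆ W) (hKW : K ⊆ W)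
    (hKS : Disjoint K S)
    (hT : ∀ v ∈ T, ∀ u ∈ insert v {u | G.Adj u v}, u ∈ S ∨ u ∈ K)
    (hT' : ∀ v ∈ W, v ∉ T → ∀ u ∈ insert v {u | G.Adj u v}, u ∉ S)
    {g : (∀ v, Ω v) → ℝ≥0∞} (hg : Measurable g) (hgS : DependsOn g (S : Set V)) :
    ∫⁻ ω, (g ω * (agree K ω₀).indicator 1 ω) * ∏ v, M.f v ω ∂(Measure.pi M.μ) =
      (∫⋯∫⁻_S, (fun ω => g ω * ∏ v ∈ T, M.f v ω) ∂M.μ) ω₀ *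
      (∫⋯∫⁻_W \ S, (fun ω => (agree K ω₀).indicator 1 ω * ∏ v ∈ W \ T, M.f v ω) ∂M.μ) ω₀ := by
  have hI : Measurable ((agree K ω₀).indicator (1 : (∀ v, Ω v) → ℝ≥0∞)) :=
    measurable_one.indicator (M.measurableSet_agree hKO ω₀)
  have hm1 : Measurable fun ω => g ω * ∏ v ∈ T, M.f v ω := hg.mul (M.measurable_prod T)
  have hm2 : Measurable fun ω => (agree K ω₀).indicator 1 ω * ∏ v ∈ W \ T, M.f v ω :=
    hI.mul (M.measurable_prod _)
  have hm12 : Measurable fun ω => ((agree K ω₀).indicator 1 ω * ∏ v ∈ W \ T, M.f v ω)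
      * (g ω * ∏ v ∈ T, M.f v ω) := hm2.mul hm1
  have hm : Measurable fun ω => (g ω * (agree K ω₀).indicator 1 ω) * ∏ v, M.f v ω :=
    (hg.mul hI).mul (M.measurable_prod _)
  have hd2 : DependsOn (fun ω => (agree K ω₀).indicator 1 ω * ∏ v ∈ W \ T, M.f v ω)
      (S : Set V)ᶜ := by
    refine ((dependsOn_indicator_agree K ω₀).mono hKS.subset_compl_right).mul'
      (dependsOn_finset_prod fun v hv => (M.dependsOn_f v).mono fun u hu => ?_)
    rw [Finset.mem_sdiff] at hv
    exact hT' v hv.1 hv.2 u hu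
  have hd1 : DependsOn (fun ω => g ω * ∏ v ∈ T, M.f v ω) ((S : Set V) ∪ K) :=
    (hgS.mono Set.subset_union_left).mul'
      (dependsOn_finset_prod fun v hv => (M.dependsOn_f v).mono fun u hu => hT v hv u hu)
  have hgd : DependsOn (fun ω => g ω * (agree K ω₀).indicator 1 ω) ((Wᶜ : Finset V) : Set V)ᶜ := by
    refine (hgS.mono ?_).mul' ((dependsOn_indicator_agree K ω₀).mono ?_)
    · simpa using hSW
    · simpa using hKW
  have hdisj : Disjoint (W \ S ∪ S) Wᶜ := by
    rw [Finset.sdiff_union_of_subset hSW]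
    exact disjoint_compl_right
  have huniv : (Finset.univ : Finset V) = (W \ S ∪ S) ∪ Wᶜ := by
    rw [Finset.sdiff_union_of_subset hSW, Finset.union_compl]
  have hprod : (fun ω => (g ω * (agree K ω₀).indicator 1 ω) * ∏ v ∈ Finset.univ \ Wᶜ, M.f v ω)
      = fun ω => ((agree K ω₀).indicator 1 ω * ∏ v ∈ W \ T, M.f v ω)
        * (g ω * ∏ v ∈ T, M.f v ω) := by
    funext ω
    rw [← Finset.compl_eq_univ_sdiff, compl_compl, ← Finset.prod_sdiff hTW]
    ring
  have hSmarg : ∫⋯∫⁻_S, (fun ω => ((agree K ω₀).indicator 1 ω * ∏ v ∈ W \ T, M.f v ω)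
        * (g ω * ∏ v ∈ T, M.f v ω)) ∂M.μ = fun ω =>
      (∫⋯∫⁻_S, (fun ω => g ω * ∏ v ∈ T, M.f v ω) ∂M.μ) ω₀ *
      ((agree K ω₀).indicator 1 ω * ∏ v ∈ W \ T, M.f v ω) := by
    funext ω
    have h1 : ∀ z : ∀ v : S, Ω v, (agree K ω₀).indicator 1 (Function.updateFinset ω S z) *
        ∏ v ∈ W \ T, M.f v (Function.updateFinset ω S z) =
        (agree K ω₀).indicator 1 ω * ∏ v ∈ W \ T, M.f v ω := fun z =>
      hd2 fun v hv => by
        have : v ∉ S := by simpa using hv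
        simp [Function.updateFinset, this]
    have h2 : Measurable fun z : ∀ v : S, Ω v => g (Function.updateFinset ω S z) *
        ∏ v ∈ T, M.f v (Function.updateFinset ω S z) := hm1.comp measurable_updateFinset
    simp only [lmarginal, h1]
    rw [lintegral_const_mul _ h2, mul_comm]
    -- The inner integral depends on the outer variables only through those in `K`, which the
    -- indicator fixes to their values in `ω₀`; hence it is a constant.
    by_cases hω : ω ∈ agree K ω₀
    · congr 1
      refine lintegral_congr fun z => hd1 fun v hv => ?_
      by_cases hvS : v ∈ S
      · simp [Function.updateFinset, hvS]
      · simpa [Function.updateFinset, hvS] using hω v (hv.resolve_left hvS)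
    · simp [hω]
  -- Integrate first over the complement of the ancestral set `W`, then over `S`, then over the rest
  -- of `W`.
  rw [lintegral_eq_lmarginal_univ ω₀, congrArg (fun s => lmarginal M.μ s _) huniv,
    lmarginal_union _ _ hm hdisj, lmarginal_mul_prod M hG _ _ (Finset.subset_univ _) ?_
      (fun ω => g ω * (agree K ω₀).indicator 1 ω) (hg.mul hI) hgd, hprod,
    lmarginal_union _ _ hm12 Finset.sdiff_disjoint, hSmarg]
  · exact lintegral_const_mul _ (hm2.comp measurable_updateFinset)
  · intro v _ hv u hu huv
    simp only [Finset.mem_compl, not_not] at hv hu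
    exact hu (hW v hv u huv)

end CausalModel

/-! ### From e-separation to proportional distributions of `Y` -/

namespace CausalModel

variable {V : Type*} [Fintype V] [DecidableEq V] {G : Digraph V} {O : Set V}
  {Ω : V → Type*} [∀ v, MeasurableSpace (Ω v)]

theorem joint_preimage_inter_agree (M : CausalModel G O Ω) {K : Set V} (hK : K ⊆ O)
    (ω₀ : ∀ v, Ω v) {Y : V} {B : Set (Ω Y)} (hB : MeasurableSet B) :
    M.joint ((fun ω => ω Y) ⁻¹' B ∩ agree K ω₀) =
      ∫⁻ ω, (B.indicator 1 (ω Y) * (agree K ω₀).indicator 1 ω) * ∏ v, M.f v ω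
        ∂(Measure.pi M.μ) := by
  rw [M.joint_apply_indicator ((measurable_pi_apply Y hB).inter (M.measurableSet_agree hK ω₀))]
  congr 1
  funext ω
  rw [Set.inter_indicator_one]
  rfl

/-- If `X` is e-separated from `Y` by `C` after deletion of `D` in the graph without the edge
`X → Y`, then the distribution of `Y` given `C = c` under `do(X = x, D = d)` is proportional to its
distribution given `X = x` and `C = c` under `do(D = d)`. -/
theorem exists_joint_intervene_eq_mul (M : CausalModel G O Ω) (hG : G.IsDAG) {X Y : V}
    {C D : Finset V} (hXO : X ∈ O) (hCO : (C : Set V) ⊆ O)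
    (hDO : (D : Set V) ⊆ O) (hiDO : ((insert X D : Finset V) : Set V) ⊆ O)
    (hXC : X ∉ C) (hXD : X ∉ D) (hYC : Y ∉ C) (hYD : Y ∉ D) (hCD : Disjoint C D)
    (hsep : (G.removeEdge X Y).ESep {X} {Y} C D) (ω₀ : ∀ v, Ω v) :
    ∃ (τ : Set (Ω Y) → ℝ≥0∞) (α β : ℝ≥0∞), ∀ B, MeasurableSet B →
      (M.intervene D hDO ω₀).joint ((fun ω => ω Y) ⁻¹' B ∩ agree (insert X C) ω₀) = τ B * α ∧
      (M.intervene (insert X D : Finset V) hiDO ω₀).joint ((fun ω => ω Y) ⁻¹' B ∩ agree C ω₀)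
        = τ B * β := by
  classical
  let H := (G.removeEdge X Y).inducedOn (D : Set V)ᶜ 
  have hHG : ∀ a b, Relation.TransGen H.Adj a b → Relation.TransGen G.Adj a.1 b.1 := by
    intro a b h
    induction h with
    | single h => exact .single h.1
    | tail _ h ih => exact ih.tail h.1
  have hHdag : H.IsDAG := fun v hv => hG v.1 (hHG _ _ hv)
  set X' : ((D : Set V)ᶜ : Set V) := ⟨X, by simpa using hXD⟩ with hX'
  set Y' : ((D : Set V)ᶜ : Set V) := ⟨Y, by simpa using hYD⟩ with hY'
  set C' : Set ((D : Set V)ᶜ : Set V) := Subtype.val ⁻¹' (C : Set V) with hC'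
  have hsep' : H.DSep {X'} {Y'} C' := by
    have h1 : (Subtype.val ⁻¹' {X} : Set ((D : Set V)ᶜ : Set V)) = {X'} := by
      ext v
      simp [hX', Subtype.ext_iff]
    have h2 : (Subtype.val ⁻¹' {Y} : Set ((D : Set V)ᶜ : Set V)) = {Y'} := by
      ext v
      simp [hY', Subtype.ext_iff]
    rw [← h1, ← h2]
    exact hsep
  obtain ⟨S₀, hYS, hXS, hSC₀, hSanc, hsplit⟩ := hsep'.exists_split hHdag (by simpa [hC', hY'] using hYC)
  set S : Finset V := Finset.univ.filter fun v => ∃ h : v ∈ (D : Set V)ᶜ, ⟨v, h⟩ ∈ S₀ with hS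
  set A : Finset V := Finset.univ.filter fun v => ∃ h : v ∈ (D : Set V)ᶜ,
    ∃ w ∈ insert X' (insert Y' C'), H.IsDescendant ⟨v, h⟩ w with hA
  set K : Set V := insert X (C ∪ D) with hK
  -- `T` collects the vertices whose factors belong to the `S` side. It avoids `X` and `D`, so
  -- neither intervention alters these factors.
  set T : Finset V := A.filter fun v => v ≠ X ∧ ∀ u ∈ insert v {u | G.Adj u v}, u ∈ S ∨ u ∈ K with hT
  have memS : ∀ v, v ∈ S ↔ ∃ h : v ∈ (D : Set V)ᶜ, ⟨v, h⟩ ∈ S₀ := by simp [hS]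
  have memA : ∀ v, v ∈ A ↔ ∃ h : v ∈ (D : Set V)ᶜ,
    ∃ w ∈ insert X' (insert Y' C'), H.IsDescendant ⟨v, h⟩ w := by simp [hA]
  have hXA : X ∈ A := (memA X).2 ⟨X'.2, X', by simp, .refl⟩
  have hXnS : X ∉ S := fun h => hXS ((memS X).1 h).2
  have hYS' : Y ∈ S := (memS Y).2 ⟨Y'.2, hYS⟩
  have hDnS : ∀ v ∈ D, v ∉ S := fun v hv h => ((memS v).1 h).1 (by simpa using hv)
  have hCA : C ⊆ A := fun v hv => by
    have hvD : v ∈ (D : Set V)ᶜ := by simpa using Finset.disjoint_left.1 hCD hv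
    exact (memA v).2 ⟨hvD, ⟨v, hvD⟩, .inr (.inr hv), .refl⟩
  have hSA : S ⊆ A := fun v hv => by
    obtain ⟨h, hv⟩ := (memS v).1 hv
    exact (memA v).2 ⟨h, hSanc _ hv⟩
  have hKO : K ⊆ O := Set.insert_subset hXO (Set.union_subset hCO hDO)
  have hSC : Disjoint (S : Set V) K := by
    refine Set.disjoint_left.2 fun v hv hvK => ?_
    obtain ⟨hvD, hv₀⟩ := (memS v).1 hv
    rcases hvK with rfl | hvC | hvD'
    · exact hXS hv₀
    · exact Set.disjoint_left.1 hSC₀ hv₀ hvC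
    · exact hvD hvD'
  have hpar : ∀ v ∈ A, ∀ u, G.Adj u v → u ∈ A ∪ D := by
    intro v hv u huv
    rw [Finset.mem_union]
    by_cases huD : u ∈ D
    · exact .inr huD
    · left
      by_cases huX : u = X
      · exact huX ▸ hXA
      · obtain ⟨hvD, w, hw, hvw⟩ := (memA v).1 hv
        exact (memA u).2 ⟨by simpa using huD, w, hw,
          .head (show H.Adj ⟨u, by simpa using huD⟩ ⟨v, hvD⟩ from ⟨huv, fun h => huX h.1⟩) hvw⟩
  -- Passing from `H` back to `G` enlarges a family only by vertices of `D` and, for `Y`, by `X`;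
  -- all of these lie in `K`.
  have hfam : ∀ v ∈ A, v ∉ T → ∀ u ∈ insert v {u | G.Adj u v}, u ∉ S := by
    intro v hv hvT u hu huS
    apply hvT
    obtain ⟨hvD, hanc⟩ := (memA v).1 hv
    obtain ⟨huD, huS₀⟩ := (memS u).1 huS
    have huX : u ≠ X := fun h => hXnS (h ▸ huS)
    have hHadj : ∀ w, ∀ hw : w ∈ (D : Set V)ᶜ, w ∈ insert v {u | G.Adj u v} → ¬ (w = X ∧ v = Y) →
        (⟨w, hw⟩ : ((D : Set V)ᶜ : Set V)) ∈ insert ⟨v, hvD⟩ {u | H.Adj u ⟨v, hvD⟩} := by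
      rintro w hw (rfl | hwv) h
      · exact .inl rfl
      · exact .inr ⟨hwv, h⟩
    rcases hsplit ⟨v, hvD⟩ hanc with h | h
    · refine Finset.mem_filter.2 ⟨hv, ?_, ?_⟩
      · rintro rfl
        rcases h X' (.inl rfl) with h | h
        · exact hXS h
        · exact hXC h
      · intro w hw
        by_cases hwD : w ∈ (D : Set V)
        · exact .inr (.inr (.inr hwD))
        by_cases hwX : w = X
        · exact .inr (.inl hwX)
        rcases h _ (hHadj w hwD hw fun h => hwX h.1) with h | h
        · exact .inl ((memS w).2 ⟨hwD, h⟩)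
        · exact .inr (.inr (.inl h))
    · exact absurd huS₀ (h _ (hHadj u huD hu fun h => huX h.1))
  have hTA : T ⊆ A := Finset.filter_subset _ _
  -- For `R = D` and `R = insert X D` alike, `A ∪ D` is ancestral after the intervention, because
  -- `D` has lost its parents. The first factor does not involve `R`: it is the common `τ`.
  have key : ∀ (R : Finset V) (hR : (R : Set V) ⊆ O), D ⊆ R → R ⊆ insert X D →
      ∀ B : Set (Ω Y), MeasurableSet B →
      (M.intervene R hR ω₀).joint ((fun ω => ω Y) ⁻¹' B ∩ agree K ω₀) =
      (∫⋯∫⁻_S, (fun ω => B.indicator 1 (ω Y) * ∏ v ∈ T, M.f v ω) ∂M.μ) ω₀ *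
      (∫⋯∫⁻_(A ∪ D) \ S, (fun ω => (agree K ω₀).indicator 1 ω *
        ∏ v ∈ (A ∪ D) \ T, (M.intervene R hR ω₀).f v ω) ∂M.μ) ω₀ := by
    intro R hR hDR hRD B hB
    rw [joint_preimage_inter_agree _ hKO ω₀ hB]
    rw [lintegral_mul_indicator_agree (M.intervene R hR ω₀) (hG.removeInto _) ω₀ (W := A ∪ D)
      (S := S) (T := T) hKO ?_ (hSA.trans Finset.subset_union_left)
      (hTA.trans Finset.subset_union_left) ?_ hSC.symm ?_ ?_
      (g := fun ω => B.indicator 1 (ω Y))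
      ((measurable_one.indicator hB).comp (measurable_pi_apply Y)) ?_]
    · have hprod : ∀ ω, ∏ v ∈ T, (M.intervene R hR ω₀).f v ω = ∏ v ∈ T, M.f v ω := by
        intro ω
        refine Finset.prod_congr rfl fun v hv => ?_
        rw [intervene_f_of_notMem]
        intro hvR
        rcases Finset.mem_insert.1 (hRD hvR) with h | h
        · exact (Finset.mem_filter.1 hv).2.1 h
        · exact ((memA v).1 (hTA hv)).1 h
      simp only [hprod]
      rfl
    · intro v hv u huv
      rcases Finset.mem_union.1 hv with hv | hv
      · exact hpar v hv u huv.1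
      · exact absurd (hDR hv) huv.2
    · refine Set.insert_subset (by simp [hXA]) (Set.union_subset ?_ ?_)
      · exact_mod_cast hCA.trans Finset.subset_union_left
      · exact_mod_cast Finset.subset_union_right
    · intro v hv u hu
      exact (Finset.mem_filter.1 hv).2.2 u (hu.imp id fun h => h.1)
    · intro v hv hvT u hu
      rcases Finset.mem_union.1 hv with hv | hv
      · exact hfam v hv hvT u (hu.imp id fun h => h.1)
      · rcases hu with rfl | hu
        · exact hDnS u hv
        · exact absurd (hDR hv) hu.2
    · intro ω ω' h
      simp only [h Y hYS']
  refine ⟨fun B => (∫⋯∫⁻_S, (fun ω => B.indicator 1 (ω Y) * ∏ v ∈ T, M.f v ω) ∂M.μ) ω₀,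
    (∫⋯∫⁻_(A ∪ D) \ S, (fun ω => (agree K ω₀).indicator 1 ω *
      ∏ v ∈ (A ∪ D) \ T, (M.intervene D hDO ω₀).f v ω) ∂M.μ) ω₀,
    (∫⋯∫⁻_(A ∪ D) \ S, (fun ω => (agree K ω₀).indicator 1 ω *
      ∏ v ∈ (A ∪ D) \ T, (M.intervene (insert X D : Finset V) hiDO ω₀).f v ω) ∂M.μ) ω₀,
    fun B hB => ⟨?_, ?_⟩⟩
  · rw [← joint_intervene_inter_agree, Set.inter_assoc, ← agree_union, Set.insert_union]
    exact key D hDO subset_rfl (Finset.subset_insert _ _) B hB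
  · have hCK : (C : Set V) ∪ (insert X D : Finset V) = K := by
      rw [Finset.coe_insert, Set.union_insert]
    rw [← joint_intervene_inter_agree, Set.inter_assoc, ← agree_union, hCK]
    exact key _ hiDO (Finset.subset_insert _ _) subset_rfl B hB

theorem condProb_eq_div {Ω' : Type*} [MeasurableSpace Ω'] (P : Measure Ω') (A : Set Ω')
    {B : Set Ω'} (hB : MeasurableSet B) : condProb P A B = P.real (A ∩ B) / P.real B := by
  rw [condProb, Measure.real, ProbabilityTheory.cond_apply hB, ENNReal.toReal_mul,
    ENNReal.toReal_inv, Set.inter_comm, div_eq_inv_mul]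
  rfl

theorem isProbabilityMeasure_joint (M : CausalModel G O Ω) (hG : G.IsDAG) (ω₀ : ∀ v, Ω v) :
    IsProbabilityMeasure M.joint :=
  haveI : Nonempty (∀ v, Ω v) := ⟨ω₀⟩
  ⟨M.joint_univ hG⟩

/-- An event of nonzero mass contains a point, whose coordinates at `X` and `D` can be overwritten.
A single configuration then carries all the prescribed values. -/
theorem exists_eq_of_joint_ne_zero (M : CausalModel G O Ω) {X : V} {C D : Finset V}
    (hXC : X ∉ C) (hXD : X ∉ D) (hCD : Disjoint C D) (x : Ω X) (d : ∀ v : D, Ω v)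
    (c : ∀ v : C, Ω v) (h : M.joint (eventEq C c) ≠ 0) :
    ∃ ω₀ : ∀ v, Ω v, x = ω₀ X ∧ d = (fun v : D => ω₀ v) ∧ c = fun v : C => ω₀ v := by
  obtain ⟨ω₁, hω₁⟩ : (eventEq C c).Nonempty := by
    by_contra hne
    rw [Set.not_nonempty_iff_eq_empty.1 hne] at h
    simp at h
  refine ⟨Function.update (Function.updateFinset ω₁ D d) X x, by simp, ?_, ?_⟩
  · funext v
    have : (v : V) ≠ X := fun h => hXD (h ▸ v.2)
    simp [Function.updateFinset, this]
  · funext v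
    have h1 : (v : V) ≠ X := fun h => hXC (h ▸ v.2)
    have h2 : (v : V) ∉ D := Finset.disjoint_left.1 hCD v.2
    simp [Function.updateFinset, h1, h2, hω₁ v]

end CausalModel

/-! ### The bounds -/

namespace CausalModel

variable {V : Type*} [Fintype V] [DecidableEq V] {G : Digraph V} {O : Set V}
  {Ω : V → Type*} [∀ v, MeasurableSpace (Ω v)]

/-- With `q = P(X = x, Y = y, C = c)` and `r = P(X = x, C = c)` under `do(D = d)`, the distribution
under `do(X = x, D = d)` satisfies `p(y | do(x, d), c) = q / r`, and `q` and `r` are related to the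
joint distribution by inequalities. -/
theorem exists_doProb_eq_div (M : CausalModel G O Ω) (hG : G.IsDAG) {X Y : V}
    {C D : Finset V} (hXO : X ∈ O) (hYO : Y ∈ O) (hCO : (C : Set V) ⊆ O)
    (hDO : (D : Set V) ⊆ O) (hXC : X ∉ C) (hXD : X ∉ D) (hYC : Y ∉ C) (hYD : Y ∉ D)
    (hCD : Disjoint C D) (hdesc : ∀ a ∈ D, ∀ b ∈ C, ¬ G.IsDescendant a b)
    (hsep : (G.removeEdge X Y).ESep {X} {Y} C D) (x : Ω X) (y : Ω Y) (d : ∀ v : D, Ω v)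
    (c : ∀ v : C, Ω v) (h0 : M.joint (eventEq C c) ≠ 0) :
    ∃ q r : ℝ,
      M.joint.real (varEq X x ∩ varEq Y y ∩ eventEq D d ∩ eventEq C c) ≤ q ∧
      M.joint.real (varEq X x ∩ eventEq D d ∩ eventEq C c) -
        M.joint.real (varEq X x ∩ varEq Y y ∩ eventEq D d ∩ eventEq C c) ≤ r - q ∧
      r - M.joint.real (varEq X x ∩ eventEq D d ∩ eventEq C c) ≤
        M.joint.real (eventEq C c) - M.joint.real (eventEq D d ∩ eventEq C c) ∧
      (r ≠ 0 → M.doJoint X D x d (eventEq C c) ≠ 0 ∧ M.doProb X Y C D x y d c = q / r) ∧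
      ((∀ a ∈ D, ¬ G.IsDescendant a X) → r = M.joint.real (varEq X x ∩ eventEq C c)) := by
  obtain ⟨ω₀, rfl, rfl, rfl⟩ := M.exists_eq_of_joint_ne_zero hXC hXD hCD x d c h0
  have hiDO : ((insert X D : Finset V) : Set V) ⊆ O := by
    rw [Finset.coe_insert]
    exact Set.insert_subset hXO hDO
  have hX : MeasurableSet (varEq X (ω₀ X)) := M.measurableSet_varEq hXO _
  have hY : MeasurableSet (varEq Y y) := M.measurableSet_varEq hYO _
  have hC : MeasurableSet (agree (C : Set V) ω₀) := M.measurableSet_agree hCO _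
  have hPprob := M.isProbabilityMeasure_joint hG ω₀
  have hQprob := (M.intervene D hDO ω₀).isProbabilityMeasure_joint (hG.removeInto _) ω₀
  have hRprob := (M.intervene (insert X D : Finset V) hiDO ω₀).isProbabilityMeasure_joint
    (hG.removeInto _) ω₀
  set P := M.joint
  set Q := (M.intervene D hDO ω₀).joint with hQ
  set R := (M.intervene (insert X D : Finset V) hiDO ω₀).joint with hR
  have hdo : M.doJoint X D (ω₀ X) (fun v : D => ω₀ v) = R := M.doJoint_eq_joint_intervene ω₀ hiDO
  have hXC' : varEq X (ω₀ X) ∩ agree (C : Set V) ω₀ = agree (insert X (C : Set V)) ω₀ := by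
    rw [varEq_eq_agree, ← agree_union, Set.insert_eq]
  have hPQ : ∀ E, P.real (E ∩ agree (D : Set V) ω₀) ≤ Q.real E := by
    intro E
    refine ENNReal.toReal_mono (measure_ne_top _ _) ?_
    have h := M.joint_intervene_le (Set.empty_subset _) ω₀ (Set.empty_subset _) hDO E
    rwa [joint_intervene_empty] at h
  -- This guarantees that conditioning on `C = c` under do(x, d) is meaningful as soon as r ≠ 0.
  have hQR : Q (varEq X (ω₀ X) ∩ agree (C : Set V) ω₀) ≤ R (agree (C : Set V) ω₀) := by
    refine le_trans (le_of_eq ?_) (M.joint_intervene_le hDO ω₀ (K' := (insert X D : Finset V))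
      (by simp) hiDO (agree (C : Set V) ω₀))
    rw [hQ, ← joint_intervene_inter_agree]
    congr 1
    rw [Finset.coe_insert, Set.insert_eq, agree_union, varEq_eq_agree]
    ac_rfl
  simp only [eventEq_eq_agree]
  refine ⟨Q.real (varEq X (ω₀ X) ∩ varEq Y y ∩ agree (C : Set V) ω₀),
    Q.real (varEq X (ω₀ X) ∩ agree (C : Set V) ω₀), ?_, ?_, ?_, fun hr => ⟨?_, ?_⟩, ?_⟩
  · rw [Set.inter_right_comm]
    exact hPQ _
  · have h1 := hPQ ((varEq X (ω₀ X) ∩ agree (C : Set V) ω₀) \ varEq Y y)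
    have h2 := measureReal_inter_add_sdiff (μ := Q)
      (s := varEq X (ω₀ X) ∩ agree (C : Set V) ω₀) hY
    have h3 := measureReal_inter_add_sdiff (μ := P)
      (s := varEq X (ω₀ X) ∩ agree (D : Set V) ω₀ ∩ agree (C : Set V) ω₀) hY
    have h4 : (varEq X (ω₀ X) ∩ agree (C : Set V) ω₀) \ varEq Y y ∩ agree (D : Set V) ω₀ =
        (varEq X (ω₀ X) ∩ agree (D : Set V) ω₀ ∩ agree (C : Set V) ω₀) \ varEq Y y := by
      rw [← Set.inter_sdiff_right_comm, Set.inter_right_comm]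
    rw [h4] at h1
    rw [Set.inter_right_comm _ _ (varEq Y y)] at h2
    rw [Set.inter_right_comm _ _ (varEq Y y), Set.inter_right_comm _ _ (varEq Y y)] at h3
    linarith
  -- Q and P give `C = c` the same mass, and Q retains at least the mass P(X ≠ x, d, c) on X ≠ x;
  -- what is left bounds r.
  · have h1 := hPQ (agree (C : Set V) ω₀ \ varEq X (ω₀ X))
    have h2 := measureReal_inter_add_sdiff (μ := Q) (s := agree (C : Set V) ω₀) hX
    have h3 := measureReal_inter_add_sdiff (μ := P)
      (s := agree (D : Set V) ω₀ ∩ agree (C : Set V) ω₀) hX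
    have h4 : Q.real (agree (C : Set V) ω₀) = P.real (agree (C : Set V) ω₀) :=
      congrArg ENNReal.toReal (M.joint_intervene_of_not_isDescendant hDO ω₀ hG hCO hdesc)
    rw [← Set.inter_sdiff_right_comm, Set.inter_comm (agree (C : Set V) ω₀)] at h1
    rw [Set.inter_comm (agree (C : Set V) ω₀)] at h2
    rw [Set.inter_comm _ (varEq X (ω₀ X)), ← Set.inter_assoc] at h3
    linarith
  · rw [hdo]
    intro h
    rw [h] at hQR
    refine hr ?_
    rw [Measure.real, nonpos_iff_eq_zero.1 hQR, ENNReal.toReal_zero]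
  -- Both conditional probabilities reduce to `τ {y} / τ univ`, as `α` and `β` cancel.
  · obtain ⟨τ, α, β, hτ⟩ := M.exists_joint_intervene_eq_mul hG hXO hCO hDO hiDO hXC hXD hYC hYD
      hCD hsep ω₀
    have hYs := M.measurableSingleton_of_observed Y hYO
    obtain ⟨hy1, hy2⟩ := hτ {y} (measurableSet_singleton y)
    obtain ⟨hu1, hu2⟩ := hτ Set.univ .univ
    rw [Set.preimage_univ, Set.univ_inter] at hu1 hu2
    rw [doProb, hdo, eventEq_eq_agree, condProb_eq_div _ _ hC]
    have e1 : varEq Y y ∩ agree (C : Set V) ω₀ = (fun ω => ω Y) ⁻¹' {y} ∩ agree C ω₀ := rfl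
    have e2 : varEq X (ω₀ X) ∩ varEq Y y ∩ agree (C : Set V) ω₀ =
        (fun ω => ω Y) ⁻¹' {y} ∩ agree (insert X (C : Set V)) ω₀ := by
      rw [← hXC', Set.inter_comm (varEq X (ω₀ X)), Set.inter_assoc]
      rfl
    have hR0 : R (agree (C : Set V) ω₀) ≠ 0 := by
      intro h
      rw [h] at hQR
      refine hr ?_
      rw [Measure.real, nonpos_iff_eq_zero.1 hQR, ENNReal.toReal_zero]
    have hR0' : R.real (agree (C : Set V) ω₀) ≠ 0 :=
      ENNReal.toReal_ne_zero.2 ⟨hR0, measure_ne_top _ _⟩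
    rw [hXC'] at hr ⊢
    rw [e1, e2]
    rw [Measure.real, hu1, ENNReal.toReal_mul] at hr
    rw [Measure.real, hu2, ENNReal.toReal_mul] at hR0'
    rw [Measure.real, Measure.real, Measure.real, Measure.real, hy1, hy2, hu1, hu2]
    simp only [ENNReal.toReal_mul]
    rw [mul_div_mul_right _ _ (right_ne_zero_of_mul hr),
      mul_div_mul_right _ _ (right_ne_zero_of_mul hR0')]
  · intro hXd
    rw [hXC']
    refine congrArg ENNReal.toReal (M.joint_intervene_of_not_isDescendant hDO ω₀ hG
      (Set.insert_subset hXO hCO) ?_)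
    rintro a ha b (rfl | hb)
    · exact hXd a ha
    · exact hdesc a ha b hb

theorem condProb_nonneg {Ω' : Type*} [MeasurableSpace Ω'] (P : Measure Ω') (A B : Set Ω') :
    0 ≤ condProb P A B := measureReal_nonneg

theorem condProb_le_one {Ω' : Type*} [MeasurableSpace Ω'] (P : Measure Ω') (A B : Set Ω') :
    condProb P A B ≤ 1 := measureReal_le_one

end CausalModel

/-- Bounds for a quotient `q / r` of masses of events, in terms of the masses `a ≤ q` and `b ≤ r` of
parts of these events, where at most `k` is missing. -/
theorem div_le_div_and_div_le_div_of_missing_mass {a b k q r : ℝ} (ha : 0 ≤ a) (hab : a ≤ b)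
    (hq : a ≤ q) (hqr : b - a ≤ r - q) (hr : r - b ≤ k) (hr0 : 0 < r) :
    a / (b + k) ≤ q / r ∧ q / r ≤ min ((a + k) / (b + k)) 1 := by
  have hbk : 0 < b + k := by linarith
  refine ⟨?_, le_min ?_ ?_⟩
  · rw [div_le_div_iff₀ hbk hr0]
    nlinarith [mul_le_mul_of_nonneg_left (show r ≤ b + k by linarith) ha,
      mul_le_mul_of_nonneg_right hq hbk.le]
  · rw [div_le_div_iff₀ hr0 hbk]
    -- With s = q - a and t = (r - q) - (b - a), the cross-multiplied difference is (b - a)(k - s) +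
    -- (a + k)t.
    nlinarith [mul_nonneg (sub_nonneg.2 hab) (show 0 ≤ k - (q - a) by linarith),
      mul_nonneg ha (show 0 ≤ r - q - (b - a) by linarith),
      mul_nonneg (show 0 ≤ k by linarith) (show 0 ≤ r - q - (b - a) by linarith)]
  · rw [div_le_one hr0]
    linarith

end

theorem theorem3 {V : Type*} [Fintype V] [DecidableEq V] (G : Digraph V) (hG : G.IsDAG)
    (O : Set V) (Ω : V → Type*) [∀ v, MeasurableSpace (Ω v)] (M : CausalModel G O Ω)
    (X Y : V) (hXY : G.Adj X Y) (C D : Finset V)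
    (hXO : X ∈ O) (hYO : Y ∈ O) (hCO : (C : Set V) ⊆ O) (hDO : (D : Set V) ⊆ O)
    (hXC : X ∉ C) (hXD : X ∉ D) (hYC : Y ∉ C) (hYD : Y ∉ D) (hCD : Disjoint C D)
    (hdesc : ∀ a ∈ D, ∀ b ∈ C, ¬ G.IsDescendant a b)
    (hsep : (G.removeEdge X Y).ESep {X} {Y} C D)
    (d : ∀ v : D, Ω v) (c : ∀ v : C, Ω v) :
    (∀ (x : Ω X) (y : Ω Y), M.BoundsDefined X C D x d c →
      M.lowerBound X Y C D x y d c ≤ M.doProb X Y C D x y d c ∧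
      M.doProb X Y C D x y d c ≤ M.upperBound X Y C D x y d c) ∧
    (∀ (x₀ x₁ : Ω X) (y₁ : Ω Y), M.BoundsDefined X C D x₀ d c → M.BoundsDefined X C D x₁ d c →
      M.lowerBound X Y C D x₁ y₁ d c - M.upperBound X Y C D x₀ y₁ d c
        ≤ M.acde X Y C D x₀ x₁ y₁ d c ∧
      M.acde X Y C D x₀ x₁ y₁ d c
        ≤ M.upperBound X Y C D x₁ y₁ d c - M.lowerBound X Y C D x₀ y₁ d c) ∧
    ((∀ a ∈ D, ¬ G.IsDescendant a X) →
      (∀ (x : Ω X) (y : Ω Y), M.joint (varEq X x ∩ eventEq C c) ≠ 0 →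
        M.BoundsDefined X C D x d c ∧
        M.lowerBound X Y C D x y d c ≤ M.tightLowerBound X Y C D x y d c ∧
        M.tightLowerBound X Y C D x y d c ≤ M.doProb X Y C D x y d c ∧
        M.doProb X Y C D x y d c ≤ M.tightUpperBound X Y C D x y d c ∧
        M.tightUpperBound X Y C D x y d c ≤ M.upperBound X Y C D x y d c) ∧
      (∀ (x₀ x₁ : Ω X) (y₁ : Ω Y), M.joint (varEq X x₀ ∩ eventEq C c) ≠ 0 →
        M.joint (varEq X x₁ ∩ eventEq C c) ≠ 0 →
        M.tightLowerBound X Y C D x₁ y₁ d c - M.tightUpperBound X Y C D x₀ y₁ d c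
          ≤ M.acde X Y C D x₀ x₁ y₁ d c ∧
        M.acde X Y C D x₀ x₁ y₁ d c
          ≤ M.tightUpperBound X Y C D x₁ y₁ d c - M.tightLowerBound X Y C D x₀ y₁ d c)) := by
  have hC : MeasurableSet (eventEq C c) := by
    have := fun v : C => M.measurableSet_varEq (hCO v.2) (c v)
    have h : eventEq C c = ⋂ v : C, varEq (v : V) (c v) := by
      ext ω
      simp [eventEq, varEq]
    rw [h]
    exact .iInter this
  have hfin : ∀ x : Ω X, M.joint (eventEq C c) ≠ 0 → IsProbabilityMeasure M.joint := by
    intro x h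
    obtain ⟨ω₀, -⟩ := M.exists_eq_of_joint_ne_zero hXC hXD hCD x d c h
    exact M.isProbabilityMeasure_joint hG ω₀
  have h1 : ∀ (x : Ω X) (y : Ω Y), M.BoundsDefined X C D x d c →
      M.lowerBound X Y C D x y d c ≤ M.doProb X Y C D x y d c ∧
      M.doProb X Y C D x y d c ≤ M.upperBound X Y C D x y d c := by
    rintro x y ⟨hp, hq, hb⟩
    have := hfin x hp
    obtain ⟨q, r, hq1, hq2, hr, hr0, -⟩ := M.exists_doProb_eq_div hG hXO hYO hCO hDO hXC hXD hYC
      hYD hCD hdesc hsep x y d c hp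
    have hpc : 0 < M.joint.real (eventEq C c) := ENNReal.toReal_pos hp (measure_ne_top _ _)
    simp only [CausalModel.lowerBound, CausalModel.upperBound]
    simp only [CausalModel.boundDenom, CausalModel.condProb_eq_div _ _ hC] at hb ⊢
    have ha0 : 0 ≤ M.joint.real (varEq X x ∩ varEq Y y ∩ eventEq D d ∩ eventEq C c) :=
      measureReal_nonneg
    have hab : M.joint.real (varEq X x ∩ varEq Y y ∩ eventEq D d ∩ eventEq C c) ≤
        M.joint.real (varEq X x ∩ eventEq D d ∩ eventEq C c) :=
      measureReal_mono (by gcongr; exact Set.inter_subset_left)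
    generalize M.joint.real (varEq X x ∩ varEq Y y ∩ eventEq D d ∩ eventEq C c) = a at *
    generalize M.joint.real (varEq X x ∩ eventEq D d ∩ eventEq C c) = b at *
    generalize M.joint.real (eventEq D d ∩ eventEq C c) = e at *
    generalize M.joint.real (eventEq C c) = p at *
    have e1 : b / p + 1 - e / p = (b + (p - e)) / p := by field_simp; ring
    have e2 : a / p + 1 - e / p = (a + (p - e)) / p := by field_simp; ring
    rw [e1] at hb ⊢
    rw [e2, div_div_div_cancel_right₀ hpc.ne', div_div_div_cancel_right₀ hpc.ne']
    have hd0 : 0 ≤ M.doProb X Y C D x y d c := CausalModel.condProb_nonneg _ _ _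
    have hd1 : M.doProb X Y C D x y d c ≤ 1 := CausalModel.condProb_le_one _ _ _
    -- If r = 0, the quotient q / r says nothing, but then a = b = 0 and the bounds are the trivial
    -- 0 and 1.
    by_cases hr' : r = 0
    · have hb0 : b = 0 := by linarith
      have ha' : a = 0 := by linarith
      have hk : p - e ≠ 0 := by
        rintro hk
        simp [hb0, hk] at hb
      simp [hb0, ha', div_self hk, hd0, hd1]
    · have hr'' : 0 < r := lt_of_le_of_ne (by linarith) (Ne.symm hr')
      obtain ⟨h1, h2⟩ := div_le_div_and_div_le_div_of_missing_mass ha0 hab hq1 hq2 hr hr''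
      rw [(hr0 hr').2] at hd0 ⊢
      exact ⟨max_le hd0 h1, h2⟩
  have h2 : (∀ a ∈ D, ¬ G.IsDescendant a X) →
      ∀ (x : Ω X) (y : Ω Y), M.joint (varEq X x ∩ eventEq C c) ≠ 0 →
        M.BoundsDefined X C D x d c ∧
        M.lowerBound X Y C D x y d c ≤ M.tightLowerBound X Y C D x y d c ∧
        M.tightLowerBound X Y C D x y d c ≤ M.doProb X Y C D x y d c ∧
        M.doProb X Y C D x y d c ≤ M.tightUpperBound X Y C D x y d c ∧
        M.tightUpperBound X Y C D x y d c ≤ M.upperBound X Y C D x y d c := by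
    intro hX x y hxc
    have hp : M.joint (eventEq C c) ≠ 0 :=
      fun h => hxc (measure_mono_null Set.inter_subset_right h)
    have := hfin x hp
    obtain ⟨q, r, hq1, hq2, hr, hr0, hrX⟩ := M.exists_doProb_eq_div hG hXO hYO hCO hDO hXC hXD
      hYC hYD hCD hdesc hsep x y d c hp
    have hpc : 0 < M.joint.real (eventEq C c) := ENNReal.toReal_pos hp (measure_ne_top _ _)
    have hr' : 0 < r := hrX hX ▸ ENNReal.toReal_pos hxc (measure_ne_top _ _)
    obtain ⟨hR, hdo⟩ := hr0 hr'.ne'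
    have hXmeas : MeasurableSet (varEq X x) := M.measurableSet_varEq hXO x
    have s1 : varEq Y y ∩ eventEq D d ∩ (varEq X x ∩ eventEq C c) =
        varEq X x ∩ varEq Y y ∩ eventEq D d ∩ eventEq C c := by ac_rfl
    have s2 : eventEq D d ∩ (varEq X x ∩ eventEq C c) =
        varEq X x ∩ eventEq D d ∩ eventEq C c := by ac_rfl
    simp only [CausalModel.BoundsDefined, CausalModel.lowerBound, CausalModel.upperBound,
      CausalModel.tightLowerBound, CausalModel.tightUpperBound, hdo]
    refine ⟨⟨hp, hR, ?_⟩, ?_⟩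
    all_goals
      simp only [CausalModel.boundDenom, CausalModel.condProb_eq_div _ _ hC,
        CausalModel.condProb_eq_div _ _ (hXmeas.inter hC), s1, s2, ← hrX hX]
      have ha0 : 0 ≤ M.joint.real (varEq X x ∩ varEq Y y ∩ eventEq D d ∩ eventEq C c) :=
        measureReal_nonneg
      have hab : M.joint.real (varEq X x ∩ varEq Y y ∩ eventEq D d ∩ eventEq C c) ≤
          M.joint.real (varEq X x ∩ eventEq D d ∩ eventEq C c) :=
        measureReal_mono (by gcongr; exact Set.inter_subset_left)
      clear hdo hrX
      generalize M.joint.real (varEq X x ∩ varEq Y y ∩ eventEq D d ∩ eventEq C c) = a at *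
      generalize M.joint.real (varEq X x ∩ eventEq D d ∩ eventEq C c) = b at *
      generalize M.joint.real (eventEq D d ∩ eventEq C c) = e at *
      generalize M.joint.real (eventEq C c) = p at *
      have e1 : b / p + 1 - e / p = (b + (p - e)) / p := by field_simp; ring
      have e2 : a / p + 1 - e / p = (a + (p - e)) / p := by field_simp; ring
      have hbk : 0 < b + (p - e) := by linarith
      rw [e1]
    · exact div_pos hbk hpc
    · have e3 : a / r + 1 - b / r = (a + (r - b)) / r := by field_simp; ring
      rw [e2, e3, div_div_div_cancel_right₀ hpc.ne', div_div_div_cancel_right₀ hpc.ne']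
      refine ⟨max_le (by positivity) ?_, ?_, ?_, le_min ?_ ?_⟩
      · exact div_le_div_of_nonneg_left ha0 hr' (by linarith)
      · exact div_le_div_of_nonneg_right hq1 hr'.le
      · exact div_le_div_of_nonneg_right (by linarith) hr'.le
      · rw [div_le_div_iff₀ hr' hbk]
        -- With k = p - e and u = r - b, the cross-multiplied difference is (b - a)(k - u).
        nlinarith [mul_nonneg (sub_nonneg.2 hab) (show 0 ≤ p - e - (r - b) by linarith)]
      · rw [div_le_one hr']
        linarith
  refine ⟨h1, fun x₀ x₁ y₁ h₀ h₁ => ?_, fun hX => ⟨h2 hX, fun x₀ x₁ y₁ h₀ h₁ => ?_⟩⟩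
  · have := h1 x₀ y₁ h₀
    have := h1 x₁ y₁ h₁
    rw [CausalModel.acde]
    constructor <;> linarith
  · have := h2 hX x₀ y₁ h₀
    have := h2 hX x₁ y₁ h₁
    rw [CausalModel.acde]
    constructor <;> linarith
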